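/- Let $\overline{H}$ denote the 2-edge-coloured graph obtained from a 2-edge-coloured (red/blue) graph $H$ by interchanging the two colours, and let $C_4$ denote the 2-edge-coloured $K_4$ whose red edges form a 4-cycle (the other two edges being blue). A 2-edge-coloured complete graph $K_n$ is called locally $\delta$-balanced if every vertex is incident to at least $\delta n$ red edges and to at least $\delta n$ blue edges. A copy of a 2-edge-coloured $K_4$ in a 2-edge-coloured $K_n$ is a set of four vertices on which the induced 2-edge-coloured complete graph is isomorphic to it by a colour-preserving bijection. There exists an absolute constant $C_1 > 0$ such that the following holds for every $\varepsilon > 0$ and every $n \neq 5$. Every locally $(1/4+\varepsilon)$-balanced 2-edge-coloured $K_n$ contains at least $2^{-C_1 (\log(1/\varepsilon))^8}\, n^4$ copies of $C_4$, or contains at least $2^{-C_1 (\log(1/\varepsilon))^8}\, n^4$ copies of $\overline{C_4}$. -/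

import Mathlib

namespace LocallyBalanced

open SimpleGraph

/-- An edge-coloured complete graph on `V` is locally `δ`-balanced if every vertex is incident to
at least `δ |V|` edges of each colour. -/
def IsLocallyBalanced {V K : Type*} [Fintype V] [DecidableEq V] [DecidableEq K]
    (c : TopEdgeLabeling V K) (δ : ℝ) : Prop :=
  ∀ (v : V) (k : K), δ * (Fintype.card V : ℝ) ≤ ((c.labelGraph k).degree v : ℝ)

/-- The copies, in an edge-coloured complete graph on `V`, of an edge-coloured complete graph `H`
on `W`. A copy is the image of a colour-preserving injection; as `H` is complete, it is determined
by its vertex set, so different injections with the same image count as one copy. -/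
def copies {V W K : Type*} [Fintype W]
    (H : TopEdgeLabeling W K) (c : TopEdgeLabeling V K) : Set (Finset V) :=
  {S | ∃ φ : W ↪ V, Finset.univ.map φ = S ∧ c.pullback φ = H}

/-- The 2-coloured `K₄` whose red edges (colour `1`) form a 4-cycle, the other two edges being
blue (colour `0`). -/
def C4 : TopEdgeLabeling (Fin 4) (Fin 2) :=
  EdgeLabeling.mk (fun i j _ => if i - j = 1 ∨ j - i = 1 then 1 else 0)
    (fun i j _ => by simp only [or_comm])

/-- Interchange the two colours. -/
def swapColours {V : Type*} (c : TopEdgeLabeling V (Fin 2)) : TopEdgeLabeling V (Fin 2) :=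
  c.compRight (Equiv.swap 0 1)

end LocallyBalanced

/-!
In a graph with neither an induced 4-cycle nor an induced `2K₂`, a maximum clique `K` with the
largest degree sum has independent complement unless there is an induced pentagon: given an edge
outside `K`, one of its ends can be exchanged for its only non-neighbour in `K`; this does not
increase the degree sum, which forces a further vertex completing a pentagon. In the presence of a
pentagon, every other vertex is adjacent to all or none of it, and these two classes play the roles
of the clique and the independent set.
So there are disjoint sets `A`, `B`, not both empty unless the graph is the pentagon, such that all
blue edges at `A` and all red edges at `B` run between `A` and `B`. Counting these at most `|A||B|`
edges gives a vertex whose degree in one colour is at most a quarter of the number of vertices.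

For the number of copies, sample `s ≈ ε⁻⁴` vertices with repetition. By a Chernoff bound the
degrees of the sample are typically still above a quarter in both colours, so at least half of the
samples contain a copy. This loses only a factor polynomial in `ε`.
-/

namespace LocallyBalanced

open SimpleGraph Finset

section PseudoSplit

variable {V W : Type*} {G : SimpleGraph V}

theorem isIndContained_of_adj_of_compl_adj {F : SimpleGraph W} (f : W → V)
    (hadj : ∀ i j, F.Adj i j → G.Adj (f i) (f j))
    (hcompl : ∀ i j, Fᶜ.Adj i j → Gᶜ.Adj (f i) (f j)) : F ⊴ G := by
  have hne : ∀ i j, i ≠ j → f i ≠ f j := fun i j hij => by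
    by_cases h : F.Adj i j
    · exact (hadj i j h).ne
    · exact (hcompl i j ((compl_adj ..).2 ⟨hij, h⟩)).ne
  refine ⟨⟨f, fun i j hij => not_imp_not.1 (hne i j) hij⟩, fun {i j} => ⟨fun h => ?_, hadj i j⟩⟩
  by_contra hij
  exact ((compl_adj ..).1 (hcompl i j ((compl_adj ..).2 ⟨fun e => h.ne (e ▸ rfl), hij⟩))).2 h

/-- Pseudo-split graphs: neither the graph nor its complement contains an induced 4-cycle. As the
complement of the 4-cycle is `2K₂`, this says that the graph has no induced `C₄` and no induced
`2K₂`. -/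
def IsPseudoSplit (G : SimpleGraph V) : Prop :=
  ¬ cycleGraph 4 ⊴ G ∧ ¬ cycleGraph 4 ⊴ Gᶜ

theorem cycleGraph_four_isIndContained {a b c d : V} (hab : G.Adj a b) (hbc : G.Adj b c)
    (hcd : G.Adj c d) (hda : G.Adj d a) (hac : Gᶜ.Adj a c) (hbd : Gᶜ.Adj b d) :
    cycleGraph 4 ⊴ G := by
  refine isIndContained_of_adj_of_compl_adj ![a, b, c, d] (fun i j hij => ?_) fun i j hij => ?_ <;>
    fin_cases i <;> fin_cases j <;>
    first
      | exact absurd hij (by decide)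
      | assumption
      | exact Adj.symm (by assumption)

theorem IsPseudoSplit.adj_diagonal (h : IsPseudoSplit G) {a b c d : V} (hab : G.Adj a b)
    (hbc : G.Adj b c) (hcd : G.Adj c d) (hda : G.Adj d a) (hac : a ≠ c) (hbd : b ≠ d) :
    G.Adj a c ∨ G.Adj b d := by
  by_contra! hn
  exact h.1 (cycleGraph_four_isIndContained hab hbc hcd hda ((compl_adj ..).2 ⟨hac, hn.1⟩)
    ((compl_adj ..).2 ⟨hbd, hn.2⟩))

theorem IsPseudoSplit.adj_between_edges (h : IsPseudoSplit G) {a b c d : V} (hab : G.Adj a b)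
    (hcd : G.Adj c d) (hac : a ≠ c) (had : a ≠ d) (hbc : b ≠ c) (hbd : b ≠ d) :
    G.Adj a c ∨ G.Adj a d ∨ G.Adj b c ∨ G.Adj b d := by
  by_contra! hn
  obtain ⟨nac, nad, nbc, nbd⟩ := hn
  exact h.2 (cycleGraph_four_isIndContained (a := a) (b := c) (c := b) (d := d)
    ((compl_adj ..).2 ⟨hac, nac⟩) ((compl_adj ..).2 ⟨hbc.symm, mt Adj.symm nbc⟩)
    ((compl_adj ..).2 ⟨hbd, nbd⟩) ((compl_adj ..).2 ⟨had.symm, mt Adj.symm nad⟩)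
    (by simpa using hab) (by simpa using hcd))

theorem IsPseudoSplit.nonadj_subset_or_subset (h : IsPseudoSplit G) {K : Set V} (hK : G.IsClique K)
    {x y : V} (hx : x ∉ K) (hy : y ∉ K) (hxy : G.Adj x y) :
    (∀ a ∈ K, ¬ G.Adj x a → ¬ G.Adj y a) ∨ ∀ a ∈ K, ¬ G.Adj y a → ¬ G.Adj x a := by
  by_contra! hn
  obtain ⟨⟨a, ha, hxa, hya⟩, b, hb, hyb, hxb⟩ := hn
  have hab : a ≠ b := fun e => hxa (e ▸ hxb)
  rcases h.adj_diagonal hxy hya (hK ha hb hab) hxb.symm (fun e => hx (e ▸ ha))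
    (fun e => hy (e ▸ hb)) with hxa' | hyb'
  exacts [hxa hxa', hyb hyb']

theorem IsPseudoSplit.adj_pentagon (h : IsPseudoSplit G) (φ : cycleGraph 5 ↪g G) {v : V}
    (hv : v ∉ Set.range φ) {i : Fin 5} (hvi : G.Adj v (φ i)) (j : Fin 5) : G.Adj v (φ j) := by
  classical
  have hne : ∀ k, v ≠ φ k := fun k e => hv ⟨k, e.symm⟩
  have hedge : ∀ k, G.Adj (φ k) (φ (k + 1)) := fun k => φ.map_adj_iff.2 (by revert k; decide)
  have hdiag : ∀ k, ¬ G.Adj (φ k) (φ (k + 2)) := fun k =>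
    φ.map_adj_iff.not.2 (by revert k; decide)
  have hdiag' : ∀ k, ¬ G.Adj (φ k) (φ (k + 3)) := fun k =>
    φ.map_adj_iff.not.2 (by revert k; decide)
  have hne₂ : ∀ k, φ k ≠ φ (k + 2) := fun k => φ.injective.ne (by revert k; decide)
  have hne₃ : ∀ k, φ k ≠ φ (k + 3) := fun k => φ.injective.ne (by revert k; decide)
  have hfill : ∀ k, G.Adj v (φ k) → G.Adj v (φ (k + 2)) → G.Adj v (φ (k + 1)) := fun k h₀ h₂ => by
    have hedge' : G.Adj (φ (k + 1)) (φ (k + 2)) := by simpa [add_assoc] using hedge (k + 1)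
    exact (h.adj_diagonal h₀ (hedge k) hedge' h₂.symm (hne _) (hne₂ k)).resolve_right (hdiag k)
  have hjump : ∀ k, G.Adj v (φ k) → G.Adj v (φ (k + 2)) ∨ G.Adj v (φ (k + 3)) := fun k h₀ => by
    have hedge' : G.Adj (φ (k + 2)) (φ (k + 3)) := by simpa [add_assoc] using hedge (k + 2)
    have := h.adj_between_edges h₀ hedge' (hne _) (hne _) (hne₂ k) (hne₃ k)
    tauto
  have hclosed : ∀ S : Finset (Fin 5), (∀ k ∈ S, k + 2 ∈ S → k + 1 ∈ S) →
      (∀ k ∈ S, k + 2 ∈ S ∨ k + 3 ∈ S) → ∀ k ∈ S, ∀ l, l ∈ S := by decide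
  simpa using hclosed {k | G.Adj v (φ k)} (by simpa using hfill) (by simpa using hjump) i
    (by simpa using hvi) j

theorem cycleGraph_five_isIndContained {a b c d e : V} (hab : G.Adj a b) (hbc : G.Adj b c)
    (hcd : G.Adj c d) (hde : G.Adj d e) (hea : G.Adj e a) (hac : Gᶜ.Adj a c) (hbd : Gᶜ.Adj b d)
    (hce : Gᶜ.Adj c e) (hda : Gᶜ.Adj d a) (heb : Gᶜ.Adj e b) : cycleGraph 5 ⊴ G := by
  refine isIndContained_of_adj_of_compl_adj ![a, b, c, d, e] (fun i j hij => ?_)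
    fun i j hij => ?_ <;>
    fin_cases i <;> fin_cases j <;>
    first
      | exact absurd hij (by decide)
      | assumption
      | exact Adj.symm (by assumption)

end PseudoSplit

section MaximumClique

variable {V : Type*} {G : SimpleGraph V}

theorem exists_isMaximumClique_degree_le_of_exchange [Fintype V] [DecidableEq V]
    (G : SimpleGraph V) [DecidableRel G.Adj] : ∃ K : Finset V, G.IsMaximumClique K ∧
      ∀ z ∈ K, ∀ x ∉ K, G.IsClique ↑(insert x (K.erase z)) → G.degree x ≤ G.degree z := by
  classical
  obtain ⟨K₀, hK₀⟩ := G.maximumClique_exists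
  obtain ⟨K, hK, hmax⟩ := exists_max_image {K : Finset V | G.IsMaximumClique K}
    (fun K => ∑ v ∈ K, G.degree v) ⟨K₀, by simpa using hK₀⟩
  simp only [mem_filter, mem_univ, true_and] at hK hmax
  refine ⟨K, hK, fun z hz x hx hclique => ?_⟩
  have hx' : x ∉ K.erase z := fun h => hx (mem_of_mem_erase h)
  have hcard : #(insert x (K.erase z)) = #K := by
    rw [card_insert_of_notMem hx', card_erase_add_one hz]
  have hsum := hmax _ ⟨hclique, fun L hL => hcard ▸ hK.maximum L hL⟩
  rw [sum_insert hx', ← add_sum_erase K _ hz] at hsum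
  omega

theorem exists_adj_not_adj_of_degree_le [Fintype V] [DecidableRel G.Adj] {x y z : V}
    (hdeg : G.degree x ≤ G.degree z) (hxy : G.Adj x y) (hzy : ¬ G.Adj z y) :
    ∃ u, G.Adj z u ∧ ¬ G.Adj x u := by
  classical
  have hy : y ∈ G.neighborFinset x \ G.neighborFinset z := by simp [hxy, hzy]
  obtain ⟨u, hu⟩ := card_pos.1 ((card_pos.2 ⟨y, hy⟩).trans_le (card_sdiff_le_card_sdiff_iff.2 hdeg))
  exact ⟨u, by simpa using hu⟩

theorem exists_not_adj_of_isMaximumClique [Finite V] {K : Finset V} (hK : G.IsMaximumClique K)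
    {x : V} (hx : x ∉ K) : ∃ z ∈ K, ¬ G.Adj x z := by
  by_contra! hall
  have hclique : G.IsClique (insert x (K : Set V)) := hK.isClique.insert fun b hb _ => hall b hb
  have hsub := hK.isMaximalClique.2 hclique (Set.subset_insert x _)
  exact hx (hsub (Set.mem_insert x _))

theorem exists_not_adj_of_isClique_exchange [Finite V] [DecidableEq V] {K : Finset V}
    (hK : G.IsMaximumClique K) {x y z : V} (hx : x ∉ K) (hy : y ∉ K) (hz : z ∈ K) (hxy : G.Adj x y)
    (hclique : G.IsClique ↑(insert x (K.erase z))) : ∃ w ∈ K, w ≠ z ∧ ¬ G.Adj y w := by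
  by_contra! hall
  have hclique' : G.IsClique ↑(insert y (insert x (K.erase z))) := by
    rw [coe_insert]
    refine hclique.insert fun b hb _ => ?_
    obtain rfl | hb := mem_insert.1 hb
    · exact hxy.symm
    · exact hall b (mem_of_mem_erase hb) (ne_of_mem_erase hb)
  have hle := hK.maximum _ hclique'
  rw [card_insert_of_notMem (by simp [hxy.ne', hy]), card_insert_of_notMem (by simp [hx]),
    card_erase_add_one hz] at hle
  omega

theorem IsPseudoSplit.isClique_exchange [DecidableEq V] (h : IsPseudoSplit G) {K : Finset V}
    (hK : G.IsClique K) {x y z : V} (hx : x ∉ K) (hy : y ∉ K) (hz : z ∈ K) (hxy : G.Adj x y)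
    (hxz : ¬ G.Adj x z) (hsub : ∀ a ∈ K, ¬ G.Adj x a → ¬ G.Adj y a) :
    G.IsClique ↑(insert x (K.erase z)) := by
  have hne : ∀ {a b}, a ∈ K → b ∉ K → b ≠ a := fun ha hb e => hb (e ▸ ha)
  rw [coe_insert]
  refine (hK.subset (by simp)).insert fun a ha _ => ?_
  obtain ⟨haz, ha⟩ := mem_erase.1 ha
  by_contra hxa
  have := h.adj_between_edges hxy (hK ha hz haz) (hne ha hx) (hne hz hx) (hne ha hy) (hne hz hy)
  have := hsub a ha hxa
  have := hsub z hz hxz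
  tauto

theorem IsPseudoSplit.cycleGraph_five_isIndContained [Fintype V] [DecidableEq V]
    [DecidableRel G.Adj] (h : IsPseudoSplit G) {K : Finset V} (hK : G.IsMaximumClique K)
    (hdeg : ∀ z ∈ K, ∀ x ∉ K, G.IsClique ↑(insert x (K.erase z)) → G.degree x ≤ G.degree z)
    {x y : V} (hx : x ∉ K) (hy : y ∉ K) (hxy : G.Adj x y)
    (hsub : ∀ a ∈ K, ¬ G.Adj x a → ¬ G.Adj y a) : cycleGraph 5 ⊴ G := by
  have hne : ∀ {a b}, a ∈ K → b ∉ K → b ≠ a := fun ha hb e => hb (e ▸ ha)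
  obtain ⟨z, hz, hxz⟩ := exists_not_adj_of_isMaximumClique hK hx
  have hyz : ¬ G.Adj y z := hsub z hz hxz
  have hswap := h.isClique_exchange hK.isClique hx hy hz hxy hxz hsub
  have hxadj : ∀ a ∈ K, a ≠ z → G.Adj x a := fun a ha haz =>
    hswap (by simp) (by simp [ha, haz]) (hne ha hx)
  obtain ⟨w, hw, hwz, hyw⟩ := exists_not_adj_of_isClique_exchange hK hx hy hz hxy hswap
  obtain ⟨u, hzu, hxu⟩ := exists_adj_not_adj_of_degree_le (hdeg z hz x hx hswap) hxy
    (mt Adj.symm hyz)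
  have hu : u ∉ K := fun hu => hxu (hxadj u hu hzu.ne')
  have hux : u ≠ x := fun e => hxz (e ▸ hzu.symm)
  have hyu : G.Adj y u := by
    have := h.adj_between_edges hxy hzu (hne hz hx) hux.symm (hne hz hy) (fun e => hxu (e ▸ hxy))
    tauto
  have hwx : G.Adj w x := (hxadj w hw hwz).symm
  have huw : ¬ G.Adj u w := fun huw => by
    have := h.adj_diagonal hxy hyu huw hwx hux.symm (hne hw hy)
    tauto
  have hzw : G.Adj z w := hK.isClique hz hw hwz.symm
  exact LocallyBalanced.cycleGraph_five_isIndContained hxy hyu hzu.symm hzw hwx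
    ((compl_adj ..).2 ⟨hux.symm, hxu⟩) ((compl_adj ..).2 ⟨hne hz hy, hyz⟩)
    ((compl_adj ..).2 ⟨hne hw hu, huw⟩) (((compl_adj ..).2 ⟨hne hz hx, hxz⟩).symm)
    (((compl_adj ..).2 ⟨hne hw hy, hyw⟩).symm)

theorem IsPseudoSplit.exists_isClique_isIndepSet_compl [Fintype V] [DecidableEq V]
    (h : IsPseudoSplit G) (h5 : ¬ cycleGraph 5 ⊴ G) :
    ∃ K : Finset V, G.IsClique K ∧ G.IsIndepSet (Kᶜ : Finset V) := by
  classical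
  obtain ⟨K, hK, hdeg⟩ := exists_isMaximumClique_degree_le_of_exchange G
  refine ⟨K, hK.isClique, fun x hx y hy _ hxy => h5 ?_⟩
  rw [mem_coe, mem_compl] at hx hy
  rcases h.nonadj_subset_or_subset hK.isClique hx hy hxy with hsub | hsub
  · exact h.cycleGraph_five_isIndContained hK hdeg hx hy hxy hsub
  · exact h.cycleGraph_five_isIndContained hK hdeg hy hx hxy.symm hsub

end MaximumClique

section SplitPair

variable {V : Type*} {G : SimpleGraph V} {A B : Finset V}

/-- Disjoint sets `A` and `B` such that a vertex of `A` is adjacent to every vertex outside `B`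
and a vertex of `B` to no vertex outside `A`. This is what survives of the clique and the
independent set of a split graph when an induced pentagon is removed from a pseudo-split graph. -/
structure IsSplitPair (G : SimpleGraph V) (A B : Finset V) : Prop where
  disjoint : Disjoint A B
  mem_of_compl_adj : ∀ a ∈ A, ∀ v, Gᶜ.Adj a v → v ∈ B
  mem_of_adj : ∀ b ∈ B, ∀ v, G.Adj b v → v ∈ A

theorem isSplitPair_compl [Fintype V] [DecidableEq V] {K : Finset V} (hK : G.IsClique K)
    (hI : G.IsIndepSet (Kᶜ : Finset V)) : IsSplitPair G K Kᶜ where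
  disjoint := disjoint_compl_right
  mem_of_compl_adj a ha v hav := mem_compl.2 fun hv => ((compl_adj ..).1 hav).2 (hK ha hv hav.ne)
  mem_of_adj b hb v hbv := by
    by_contra hv
    exact hI hb (by simpa using hv) hbv.ne hbv

open scoped Classical in
theorem IsPseudoSplit.isSplitPair_pentagon [Fintype V] (h : IsPseudoSplit G)
    (φ : cycleGraph 5 ↪g G) :
    IsSplitPair G ({v | v ∉ Set.range φ ∧ G.Adj v (φ 0)} : Finset V)
      ({v | v ∉ Set.range φ ∧ ¬ G.Adj v (φ 0)} : Finset V) where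
  disjoint := disjoint_filter.2 fun v _ h₁ h₂ => h₂.2 h₁.2
  mem_of_compl_adj a ha v hav := by
    obtain ⟨har, ha₀⟩ : a ∉ Set.range φ ∧ G.Adj a (φ 0) := by simpa using ha
    obtain ⟨hne, hnadj⟩ := (compl_adj ..).1 hav
    have hvr : v ∉ Set.range φ := by
      rintro ⟨j, rfl⟩
      exact hnadj (h.adj_pentagon φ har ha₀ j)
    refine mem_filter.2 ⟨mem_univ v, hvr, fun hv₀ => ?_⟩
    have hdiag : φ 0 ≠ φ 2 := φ.injective.ne (by decide)
    have hndiag : ¬ G.Adj (φ 0) (φ 2) := φ.map_adj_iff.not.2 (by decide)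
    have := h.adj_diagonal ha₀ hv₀.symm (h.adj_pentagon φ hvr hv₀ 2)
      (h.adj_pentagon φ har ha₀ 2).symm hne hdiag
    tauto
  mem_of_adj b hb v hbv := by
    obtain ⟨hbr, hb₀⟩ : b ∉ Set.range φ ∧ ¬ G.Adj b (φ 0) := by simpa using hb
    have hbφ : ∀ j, ¬ G.Adj b (φ j) := fun j hj => hb₀ (h.adj_pentagon φ hbr hj 0)
    have hvr : v ∉ Set.range φ := by
      rintro ⟨j, rfl⟩
      exact hbφ j hbv
    have hne : ∀ {u}, u ∉ Set.range φ → ∀ j, u ≠ φ j := fun hu j e => hu ⟨j, e.symm⟩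
    have hedge : G.Adj (φ 0) (φ 1) := φ.map_adj_iff.2 (by decide)
    have := h.adj_between_edges hbv hedge (hne hbr 0) (hne hbr 1) (hne hvr 0) (hne hvr 1)
    have hv₀ : G.Adj v (φ 0) := by
      by_contra hv₀
      have hv₁ : G.Adj v (φ 1) := by tauto
      exact hv₀ (h.adj_pentagon φ hvr hv₁ 0)
    exact mem_filter.2 ⟨mem_univ v, hvr, hv₀⟩

theorem IsPseudoSplit.exists_isSplitPair [Fintype V] [Nonempty V] (h : IsPseudoSplit G)
    (hV : Fintype.card V ≠ 5) :
    ∃ A B : Finset V, IsSplitPair G A B ∧ (A.Nonempty ∨ B.Nonempty) := by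
  classical
  by_cases h5 : cycleGraph 5 ⊴ G
  · obtain ⟨φ⟩ := h5
    obtain ⟨v, hv⟩ : ∃ v, v ∉ Set.range φ := by
      by_contra! hsurj
      exact hV (by simpa using (Fintype.card_of_bijective ⟨φ.injective, hsurj⟩).symm)
    refine ⟨_, _, h.isSplitPair_pentagon φ, ?_⟩
    by_cases hv₀ : G.Adj v (φ 0)
    · exact Or.inl ⟨v, by simpa using ⟨by simpa using hv, hv₀⟩⟩
    · exact Or.inr ⟨v, by simpa using ⟨by simpa using hv, hv₀⟩⟩
  · obtain ⟨K, hK, hI⟩ := h.exists_isClique_isIndepSet_compl h5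
    obtain ⟨v⟩ := ‹Nonempty V›
    refine ⟨K, Kᶜ, isSplitPair_compl hK hI, ?_⟩
    by_cases hv : v ∈ K
    exacts [Or.inl ⟨v, hv⟩, Or.inr ⟨v, mem_compl.2 hv⟩]

variable [Fintype V] [DecidableEq V] [DecidableRel G.Adj]

theorem IsSplitPair.sum_degree_le (h : IsSplitPair G A B) :
    ∑ a ∈ A, Gᶜ.degree a + ∑ b ∈ B, G.degree b ≤ #A * #B := by
  have hA : ∀ a ∈ A, Gᶜ.degree a ≤ #{b ∈ B | ¬ G.Adj a b} := fun a ha => by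
    rw [← card_neighborFinset_eq_degree]
    refine card_le_card fun v hv => ?_
    rw [mem_neighborFinset] at hv
    exact mem_filter.2 ⟨h.mem_of_compl_adj a ha v hv, ((compl_adj ..).1 hv).2⟩
  have hB : ∀ b ∈ B, G.degree b ≤ #{a ∈ A | G.Adj a b} := fun b hb => by
    rw [← card_neighborFinset_eq_degree]
    refine card_le_card fun v hv => ?_
    rw [mem_neighborFinset] at hv
    exact mem_filter.2 ⟨h.mem_of_adj b hb v hv, hv.symm⟩
  calc ∑ a ∈ A, Gᶜ.degree a + ∑ b ∈ B, G.degree b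
      ≤ ∑ a ∈ A, #{b ∈ B | ¬ G.Adj a b} + ∑ b ∈ B, #{a ∈ A | G.Adj a b} :=
        add_le_add (sum_le_sum hA) (sum_le_sum hB)
    _ = ∑ a ∈ A, #{b ∈ B | ¬ G.Adj a b} + ∑ a ∈ A, #{b ∈ B | G.Adj a b} := by
        congr 1
        exact (sum_card_bipartiteAbove_eq_sum_card_bipartiteBelow G.Adj).symm
    _ = #A * #B := by
        rw [← sum_add_distrib, sum_const_nat fun a _ => ?_]
        rw [add_comm, card_filter_add_card_filter_not]

theorem IsSplitPair.exists_four_mul_degree_le (h : IsSplitPair G A B)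
    (hne : A.Nonempty ∨ B.Nonempty) :
    ∃ v, 4 * G.degree v ≤ Fintype.card V ∨ 4 * Gᶜ.degree v ≤ Fintype.card V := by
  by_contra! hlt
  have hcard : #A + #B ≤ Fintype.card V := card_union_of_disjoint h.disjoint ▸ card_le_univ _
  have hA := sum_le_sum fun a (_ : a ∈ A) => Nat.succ_le_of_lt (hlt a).2
  have hB := sum_le_sum fun b (_ : b ∈ B) => Nat.succ_le_of_lt (hlt b).1
  simp only [sum_const, smul_eq_mul, ← mul_sum, Nat.succ_eq_add_one] at hA hB
  have hpos : 0 < #A + #B := by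
    rcases hne with hne | hne <;> have := hne.card_pos <;> omega
  have hsum := h.sum_degree_le
  nlinarith [four_mul_le_pow_two_add #A #B, Nat.mul_le_mul_right (#A + #B) hcard]

theorem cycleGraph_four_isIndContained_or_compl [Nonempty V] (hV : Fintype.card V ≠ 5)
    (hdeg : ∀ v, Fintype.card V < 4 * G.degree v)
    (hcodeg : ∀ v, Fintype.card V < 4 * Gᶜ.degree v) :
    cycleGraph 4 ⊴ G ∨ cycleGraph 4 ⊴ Gᶜ := by
  by_contra! hsplit
  obtain ⟨A, B, hAB, hne⟩ := IsPseudoSplit.exists_isSplitPair hsplit hV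
  obtain ⟨v, hv | hv⟩ := hAB.exists_four_mul_degree_le hne
  exacts [(hdeg v).not_ge hv, (hcodeg v).not_ge hv]

end SplitPair

section Sampling

variable {ι V : Type*} [Fintype ι] [DecidableEq ι] [Fintype V]

theorem sum_exp_weight_le [DecidableEq V] {S : Finset V} {p ε : ℝ} (hp : 0 ≤ p) (hε : 0 ≤ ε)
    (hS : (p + ε) * Fintype.card V ≤ #S) :
    ∑ v, (if v ∈ S then Real.exp (-(ε / 2)) else 1) ≤
      Fintype.card V * Real.exp (-(ε / 2 * p + ε ^ 2 / 4)) := by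
  rcases isEmpty_or_nonempty V with hV | hV
  · simp
  have hcard : (0 : ℝ) < Fintype.card V := by exact_mod_cast Fintype.card_pos
  have hle_one : p + ε ≤ 1 := by
    refine le_of_mul_le_mul_right (hS.trans ?_) hcard
    simpa using card_le_univ S
  have hexp : ε / 2 - (ε / 2) ^ 2 ≤ 1 - Real.exp (-(ε / 2)) := by
    have := (abs_le.1 (Real.abs_exp_sub_one_sub_id_le (x := -(ε / 2))
      (by rw [abs_neg, abs_of_nonneg (by positivity)]; linarith))).2
    linarith
  have hsum : ∑ v, (if v ∈ S then Real.exp (-(ε / 2)) else 1) =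
      Fintype.card V - #S * (1 - Real.exp (-(ε / 2))) := by
    have hsplit : ∀ v, (if v ∈ S then Real.exp (-(ε / 2)) else 1) =
        1 - if v ∈ S then 1 - Real.exp (-(ε / 2)) else 0 := fun v => by
      split_ifs <;> ring
    simp [hsplit, mul_sub]
  have hweight : ((p + ε) * Fintype.card V) * (ε / 2 - (ε / 2) ^ 2) ≤
      #S * (1 - Real.exp (-(ε / 2))) :=
    mul_le_mul hS hexp (by nlinarith) (by positivity)
  have hrate : ε / 2 * p + ε ^ 2 / 4 ≤ (p + ε) * (ε / 2 - (ε / 2) ^ 2) := by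
    nlinarith [mul_le_mul_of_nonneg_right hle_one (sq_nonneg (ε / 2))]
  calc ∑ v, (if v ∈ S then Real.exp (-(ε / 2)) else 1)
      ≤ Fintype.card V * (1 - (ε / 2 * p + ε ^ 2 / 4)) := by
        rw [hsum]
        nlinarith [mul_le_mul_of_nonneg_left hrate hcard.le]
    _ ≤ Fintype.card V * Real.exp (-(ε / 2 * p + ε ^ 2 / 4)) := by
        gcongr
        exact Real.one_sub_le_exp_neg _

theorem card_few_hits_le [DecidableEq V] {S : Finset V} {p ε : ℝ} (hp : 0 ≤ p) (hε : 0 ≤ ε)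
    (hS : (p + ε) * Fintype.card V ≤ #S) :
    (#{f : ι → V | (#{i | f i ∈ S} : ℝ) ≤ p * Fintype.card ι} : ℝ) ≤
      (Fintype.card V : ℝ) ^ Fintype.card ι * Real.exp (-(ε ^ 2 / 4 * Fintype.card ι)) := by
  set m := Fintype.card ι with hm
  let w : V → ℝ := fun v => if v ∈ S then Real.exp (-(ε / 2)) else 1
  have hw : ∀ v, 0 ≤ w v := fun v => by
    simp only [w]
    split_ifs <;> positivity
  have hprod : ∀ f : ι → V, ∏ i, w (f i) = Real.exp (-(ε / 2 * #{i | f i ∈ S})) := fun f => by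
    simp only [w]
    rw [prod_ite, prod_const_one, mul_one, prod_const, ← Real.exp_nat_mul]
    ring_nf
  calc (#{f : ι → V | (#{i | f i ∈ S} : ℝ) ≤ p * m} : ℝ)
      = ∑ f : ι → V with (#{i | f i ∈ S} : ℝ) ≤ p * m, (1 : ℝ) := by simp
    _ ≤ ∑ f : ι → V with (#{i | f i ∈ S} : ℝ) ≤ p * m,
          Real.exp (ε / 2 * (p * m)) * ∏ i, w (f i) := by
        refine sum_le_sum fun f hf => ?_
        rw [hprod, ← Real.exp_add]
        have := mul_le_mul_of_nonneg_left (mem_filter.1 hf).2 (show 0 ≤ ε / 2 by positivity)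
        exact Real.one_le_exp (by linarith)
    _ ≤ ∑ f : ι → V, Real.exp (ε / 2 * (p * m)) * ∏ i, w (f i) :=
        sum_le_sum_of_subset_of_nonneg (filter_subset ..) fun f _ _ =>
          mul_nonneg (Real.exp_nonneg _) (prod_nonneg fun i _ => hw _)
    _ = Real.exp (ε / 2 * (p * m)) * (∑ v, w v) ^ m := by
        rw [← mul_sum, ← Fintype.prod_sum fun (_ : ι) v => w v, prod_const, card_univ]
    _ ≤ Real.exp (ε / 2 * (p * m)) *
          (Fintype.card V * Real.exp (-(ε / 2 * p + ε ^ 2 / 4))) ^ m := by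
        have := sum_nonneg fun v (_ : v ∈ univ) => hw v
        gcongr
        exact sum_exp_weight_le hp hε hS
    _ = (Fintype.card V : ℝ) ^ m * Real.exp (-(ε ^ 2 / 4 * m)) := by
        rw [mul_pow, ← Real.exp_nat_mul, mul_left_comm, ← Real.exp_add]
        ring_nf

theorem card_few_neighbors_at_le {H : SimpleGraph V} [DecidableRel H.Adj] {p ε : ℝ} (hp : 0 ≤ p)
    (hε : 0 ≤ ε) (hdeg : ∀ v, (p + ε) * Fintype.card V ≤ H.degree v) (i : ι) :
    (#{f : ι → V | (#{j | H.Adj (f i) (f j)} : ℝ) ≤ p * (Fintype.card ι - 1 : ℕ)} : ℝ) ≤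
      (Fintype.card V : ℝ) ^ Fintype.card ι *
        Real.exp (-(ε ^ 2 / 4 * (Fintype.card ι - 1 : ℕ))) := by
  classical
  have hι : Fintype.card {j // j ≠ i} = Fintype.card ι - 1 := by simp
  let few (v : V) : Finset ({j // j ≠ i} → V) :=
    {g | (#{j | g j ∈ H.neighborFinset v} : ℝ) ≤ p * Fintype.card {j // j ≠ i}}
  have hmaps : ∀ f : ι → V, (#{j | H.Adj (f i) (f j)} : ℝ) ≤ p * (Fintype.card ι - 1 : ℕ) →
      (fun j : {j // j ≠ i} => f j) ∈ few (f i) := fun f hf => by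
    refine mem_filter.2 ⟨mem_univ _, ?_⟩
    rw [hι]
    refine le_trans (Nat.cast_le.2 ?_) hf
    rw [← card_map (Function.Embedding.subtype (· ≠ i))]
    exact card_le_card fun j hj => by
      obtain ⟨k, hk, rfl⟩ := mem_map.1 hj
      simpa using hk
  have hfibres : #{f : ι → V | (#{j | H.Adj (f i) (f j)} : ℝ) ≤ p * (Fintype.card ι - 1 : ℕ)} ≤
      ∑ v, #(few v) := by
    rw [← card_sigma]
    refine card_le_card_of_injOn (fun f => ⟨f i, fun j => f j⟩)
      (fun f hf => by simpa using hmaps f (by simpa using hf)) fun f _ g _ hfg => ?_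
    exact (Equiv.funSplitAt i V).injective (by simpa [Equiv.funSplitAt, Equiv.piSplitAt] using hfg)
  calc (#{f : ι → V | (#{j | H.Adj (f i) (f j)} : ℝ) ≤ p * (Fintype.card ι - 1 : ℕ)} : ℝ)
      ≤ ∑ v, (#(few v) : ℝ) := by exact_mod_cast hfibres
    _ ≤ ∑ _v : V, (Fintype.card V : ℝ) ^ (Fintype.card ι - 1) *
          Real.exp (-(ε ^ 2 / 4 * (Fintype.card ι - 1 : ℕ))) := by
        refine sum_le_sum fun v _ => ?_
        rw [← hι]
        exact card_few_hits_le hp hε (by simpa using hdeg v)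
    _ = (Fintype.card V : ℝ) ^ Fintype.card ι *
          Real.exp (-(ε ^ 2 / 4 * (Fintype.card ι - 1 : ℕ))) := by
        rw [sum_const, card_univ, nsmul_eq_mul, ← mul_assoc, mul_pow_sub_one]
        exact (Fintype.card_pos_iff.2 ⟨i⟩).ne'

theorem card_exists_few_neighbors_le {H : SimpleGraph V} [DecidableRel H.Adj] {p ε : ℝ}
    (hp : 0 ≤ p) (hε : 0 ≤ ε) (hdeg : ∀ v, (p + ε) * Fintype.card V ≤ H.degree v) :
    (#{f : ι → V | ∃ i, (#{j | H.Adj (f i) (f j)} : ℝ) ≤ p * (Fintype.card ι - 1 : ℕ)} : ℝ) ≤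
      Fintype.card ι * ((Fintype.card V : ℝ) ^ Fintype.card ι *
        Real.exp (-(ε ^ 2 / 4 * (Fintype.card ι - 1 : ℕ)))) := by
  classical
  have hunion : #{f : ι → V | ∃ i, (#{j | H.Adj (f i) (f j)} : ℝ) ≤ p * (Fintype.card ι - 1 : ℕ)} ≤
      ∑ i : ι, #{f : ι → V | (#{j | H.Adj (f i) (f j)} : ℝ) ≤ p * (Fintype.card ι - 1 : ℕ)} := by
    refine (card_le_card fun f hf => ?_).trans card_biUnion_le
    simpa using hf
  calc _ ≤ ∑ i : ι, (#{f : ι → V | (#{j | H.Adj (f i) (f j)} : ℝ) ≤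
          p * (Fintype.card ι - 1 : ℕ)} : ℝ) := by exact_mod_cast hunion
    _ ≤ _ := by
      rw [← nsmul_eq_mul, ← card_univ (α := ι)]
      exact sum_le_card_nsmul _ _ _ fun i _ => card_few_neighbors_at_le hp hε hdeg i

theorem lt_one_of_le_degree [Nonempty V] {H : SimpleGraph V} [DecidableRel H.Adj] {ε : ℝ}
    (hdeg : ∀ v, (1 / 4 + ε) * Fintype.card V ≤ H.degree v) : ε < 1 := by
  obtain ⟨v⟩ := ‹Nonempty V›
  have hlt : (H.degree v : ℝ) < Fintype.card V := by exact_mod_cast H.degree_lt_card_verts v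
  nlinarith [hdeg v]

theorem card_exists_degree_le_quarter_le [Nonempty V] {H : SimpleGraph V} [DecidableRel H.Adj]
    {ε : ℝ} (hε : 0 < ε) (hdeg : ∀ v, (1 / 4 + ε) * Fintype.card V ≤ H.degree v)
    (hι : 2 ^ 14 ≤ ε ^ 4 * Fintype.card ι) :
    (#{f : ι → V | ∃ i, 4 * #{j | H.Adj (f i) (f j)} ≤ Fintype.card ι} : ℝ) ≤
      (Fintype.card V : ℝ) ^ Fintype.card ι / 8 := by
  set s := Fintype.card ι
  have hε₁ := lt_one_of_le_degree hdeg
  have hs : 2 ^ 14 ≤ ε * s := hι.trans <| by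
    gcongr
    exact pow_le_of_le_one hε.le hε₁.le (by norm_num)
  have hs₁ : (1 : ℝ) < s := by nlinarith
  have hsub : ((s - 1 : ℕ) : ℝ) = s - 1 := Nat.cast_pred (by exact_mod_cast one_pos.trans hs₁)
  have hexp : 8 * s ≤ Real.exp (ε ^ 2 / 16 * (s - 1)) := by
    have hquad := Real.quadratic_le_exp_of_nonneg (x := ε ^ 2 * s / 32) (by positivity)
    have hhalf : ε ^ 2 * s / 32 ≤ ε ^ 2 / 16 * (s - 1) := by nlinarith [sq_nonneg ε]
    have hmono := Real.exp_le_exp.2 hhalf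
    nlinarith
  have hchernoff := card_exists_few_neighbors_le (ι := ι) (H := H) (p := 1 / 4 + ε / 2)
    (ε := ε / 2) (by positivity) (by positivity) (fun v => by linarith [hdeg v])
  have hmono : #{f : ι → V | ∃ i, 4 * #{j | H.Adj (f i) (f j)} ≤ s} ≤
      #{f : ι → V | ∃ i, (#{j | H.Adj (f i) (f j)} : ℝ) ≤ (1 / 4 + ε / 2) * (s - 1 : ℕ)} := by
    refine card_le_card fun f hf => ?_
    simp only [mem_filter, mem_univ, true_and] at hf ⊢
    refine hf.imp fun i hi => ?_
    have hi' : (4 * #{j | H.Adj (f i) (f j)} : ℝ) ≤ s := by exact_mod_cast hi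
    rw [hsub]
    linarith
  refine (Nat.cast_le.2 hmono).trans (hchernoff.trans ?_)
  rw [hsub, Real.exp_neg, show (ε / 2) ^ 2 / 4 = ε ^ 2 / 16 by ring, le_div_iff₀ (by norm_num)]
  have hpow : (0 : ℝ) ≤ (Fintype.card V : ℝ) ^ s := by positivity
  calc _ = (Fintype.card V : ℝ) ^ s * (8 * s / Real.exp (ε ^ 2 / 16 * (s - 1))) := by ring
    _ ≤ (Fintype.card V : ℝ) ^ s :=
        mul_le_of_le_one_right hpow (div_le_one_of_le₀ hexp (by positivity))

theorem three_mul_pow_le_four_mul_descFactorial {n k : ℕ} (hn : 4 * k ^ 2 ≤ n) :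
    3 * n ^ k ≤ 4 * n.descFactorial k := by
  rcases Nat.eq_zero_or_pos k with rfl | hk
  · simp
  have hkn : k ≤ n := by nlinarith
  have hn₀ : (0 : ℝ) < n := by exact_mod_cast hk.trans_le hkn
  have hn' : (4 * k ^ 2 : ℝ) ≤ n := by exact_mod_cast hn
  have hkn' : (k : ℝ) ≤ n := by exact_mod_cast hkn
  have hbernoulli : 3 / 4 ≤ (1 + -(k / n : ℝ)) ^ k := by
    have hle := one_add_mul_le_pow (a := -(k / n : ℝ))
      (by linarith [(div_le_one hn₀).2 hkn']) k
    have hsq : k * (k / n : ℝ) ≤ 1 / 4 := by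
      rw [mul_div_assoc', div_le_iff₀ hn₀]
      linarith
    linarith
  have hdesc : ((n : ℝ) - k) ^ k ≤ n.descFactorial k := by
    have hle : (n - k) ^ k ≤ n.descFactorial k :=
      (Nat.pow_le_pow_left (by omega) k).trans (n.pow_sub_le_descFactorial k)
    rw [← Nat.cast_sub hkn]
    exact_mod_cast hle
  have hfactor : ((n : ℝ) - k) ^ k = n ^ k * (1 + -(k / n : ℝ)) ^ k := by
    rw [← mul_pow]
    congr 1
    field_simp
    ring
  have hreal : (3 * n ^ k : ℝ) ≤ 4 * n.descFactorial k := by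
    have := mul_le_mul_of_nonneg_left hbernoulli (pow_nonneg hn₀.le k)
    linarith
  exact_mod_cast hreal

theorem four_mul_card_not_injective_le [DecidableEq V]
    (hV : 4 * Fintype.card ι ^ 2 ≤ Fintype.card V) :
    4 * #{f : ι → V | ¬ f.Injective} ≤ Fintype.card V ^ Fintype.card ι := by
  have hinj : #{f : ι → V | f.Injective} = (Fintype.card V).descFactorial (Fintype.card ι) := by
    rw [← Fintype.card_embedding_eq, ← Fintype.card_subtype]
    exact Fintype.card_congr (Equiv.subtypeInjectiveEquivEmbedding ι V)
  have htotal := card_filter_add_card_filter_not (s := univ) fun f : ι → V => f.Injective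
  rw [hinj, card_univ, Fintype.card_fun] at htotal
  have := three_mul_pow_le_four_mul_descFactorial hV
  omega

variable {κ : Type*} [Fintype κ]

theorem card_comp_mem_le [DecidableEq V] (Q : Finset (κ → V)) (e : κ ↪ ι) :
    #{f : ι → V | f ∘ e ∈ Q} ≤ #Q * Fintype.card V ^ (Fintype.card ι - Fintype.card κ) := by
  classical
  have hcompl : Fintype.card {i // i ∉ Set.range e} = Fintype.card ι - Fintype.card κ := by
    rw [Fintype.card_subtype_compl, Fintype.card_congr (Equiv.ofInjective e e.injective).symm]
  rw [← hcompl, ← Fintype.card_fun, ← card_univ, ← card_product]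
  refine card_le_card_of_injOn (fun f => (f ∘ e, fun i => f i))
    (fun f hf => by simpa using hf) fun f _ g _ hfg => funext fun i => ?_
  obtain ⟨hrange, houtside⟩ := Prod.mk.inj hfg
  by_cases hi : i ∈ Set.range e
  · obtain ⟨k, rfl⟩ := hi
    exact congrFun hrange k
  · exact congrFun houtside ⟨i, hi⟩

theorem card_exists_comp_mem_le [DecidableEq V] (Q : Finset (κ → V)) :
    #{f : ι → V | ∃ e : κ ↪ ι, f ∘ e ∈ Q} ≤ Fintype.card ι ^ Fintype.card κ *
      (#Q * Fintype.card V ^ (Fintype.card ι - Fintype.card κ)) := by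
  classical
  calc #{f : ι → V | ∃ e : κ ↪ ι, f ∘ e ∈ Q}
      ≤ #(univ.biUnion fun e : κ ↪ ι => {f : ι → V | f ∘ e ∈ Q}) :=
        card_le_card fun f hf => by simpa using hf
    _ ≤ Fintype.card (κ ↪ ι) * (#Q * Fintype.card V ^ (Fintype.card ι - Fintype.card κ)) :=
        card_biUnion_le_card_mul _ _ _ fun e _ => card_comp_mem_le Q e
    _ ≤ _ := by
        rw [Fintype.card_embedding_eq]
        gcongr
        exact Nat.descFactorial_le_pow ..

theorem pow_card_le_of_half_samples [Nonempty V] [DecidableEq V] {Q : Finset (κ → V)}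
    (hκ : Fintype.card κ ≤ Fintype.card ι)
    (hQ : Fintype.card V ^ Fintype.card ι ≤ 2 * #{f : ι → V | ∃ e : κ ↪ ι, f ∘ e ∈ Q}) :
    Fintype.card V ^ Fintype.card κ ≤ 2 * Fintype.card ι ^ Fintype.card κ * #Q := by
  have hpos : 0 < Fintype.card V ^ (Fintype.card ι - Fintype.card κ) := pow_pos Fintype.card_pos _
  refine Nat.le_of_mul_le_mul_right ?_ hpos
  calc Fintype.card V ^ Fintype.card κ * Fintype.card V ^ (Fintype.card ι - Fintype.card κ)
      = Fintype.card V ^ Fintype.card ι := by rw [← pow_add, Nat.add_sub_cancel' hκ]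
    _ ≤ _ := hQ.trans (Nat.mul_le_mul_left 2 (card_exists_comp_mem_le Q))
    _ = _ := by ring

end Sampling

section Supersaturation

variable {V : Type*} {G : SimpleGraph V}

theorem exists_comp_eq_cycleGraph_four {ι : Type*} [Fintype ι] [Nonempty ι] [DecidableRel G.Adj]
    [DecidableRel Gᶜ.Adj] {f : ι → V} (hf : f.Injective) (hι : Fintype.card ι ≠ 5)
    (hdeg : ∀ i, Fintype.card ι < 4 * #{j | G.Adj (f i) (f j)})
    (hcodeg : ∀ i, Fintype.card ι < 4 * #{j | Gᶜ.Adj (f i) (f j)}) :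
    ∃ e : Fin 4 ↪ ι, (∃ φ : cycleGraph 4 ↪g G, φ = f ∘ e) ∨
      ∃ φ : cycleGraph 4 ↪g Gᶜ, φ = f ∘ e := by
  classical
  let φ : G.comap f ↪g G := Embedding.comap ⟨f, hf⟩ G
  have hsample : cycleGraph 4 ⊴ G.comap f ∨ cycleGraph 4 ⊴ (G.comap f)ᶜ := by
    refine cycleGraph_four_isIndContained_or_compl hι (fun i => ?_) fun i => ?_
    · simpa [← card_neighborFinset_eq_degree, neighborFinset_eq_filter] using hdeg i
    · simpa [← card_neighborFinset_eq_degree, neighborFinset_eq_filter, hf.ne_iff] using hcodeg i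
  rcases hsample with hψ | hψ <;> obtain ⟨ψ⟩ := hψ
  · exact ⟨ψ.toEmbedding, Or.inl ⟨φ.comp ψ, rfl⟩⟩
  · exact ⟨ψ.toEmbedding, Or.inr ⟨(Embedding.complEquiv φ).comp ψ, rfl⟩⟩

theorem five_lt_of_le_pow_four_mul {ε : ℝ} (hε : 0 < ε) (hε₁ : ε < 1) {s : ℕ}
    (hs : 2 ^ 14 ≤ ε ^ 4 * s) : 5 < s := by
  have hpow : ε ^ 4 * s ≤ s := mul_le_of_le_one_left (Nat.cast_nonneg s) (pow_le_one₀ hε.le hε₁.le)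
  have hlt : (5 : ℝ) < s := by linarith
  exact_mod_cast hlt

variable [Fintype V] [Nonempty V] [DecidableEq V] [DecidableRel G.Adj] {ε : ℝ} {s : ℕ}

theorem card_pow_le_two_mul_card_exists_comp_mem (hε : 0 < ε)
    (hdeg : ∀ v, (1 / 4 + ε) * Fintype.card V ≤ G.degree v)
    (hcodeg : ∀ v, (1 / 4 + ε) * Fintype.card V ≤ Gᶜ.degree v) (hs : 2 ^ 14 ≤ ε ^ 4 * s)
    (hV : 4 * s ^ 2 ≤ Fintype.card V) {Q : Finset (Fin 4 → V)}
    (hQ : ∀ φ : cycleGraph 4 ↪g G, ⇑φ ∈ Q) (hQ' : ∀ φ : cycleGraph 4 ↪g Gᶜ, ⇑φ ∈ Q) :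
    Fintype.card V ^ s ≤ 2 * #{f : Fin s → V | ∃ e : Fin 4 ↪ Fin s, f ∘ e ∈ Q} := by
  have hs₅ := five_lt_of_le_pow_four_mul hε (lt_one_of_le_degree hdeg) hs
  have : Nonempty (Fin s) := Fin.pos_iff_nonempty.1 (by omega)
  let few (H : SimpleGraph V) [DecidableRel H.Adj] : Finset (Fin s → V) :=
    {f | ∃ i, 4 * #{j | H.Adj (f i) (f j)} ≤ Fintype.card (Fin s)}
  let collide : Finset (Fin s → V) := {f | ¬ f.Injective}
  let hit : Finset (Fin s → V) := {f | ∃ e : Fin 4 ↪ Fin s, f ∘ e ∈ Q}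
  have hcover : univ ⊆ few G ∪ few Gᶜ ∪ collide ∪ hit := fun f _ => by
    by_contra hf
    simp only [few, collide, hit, mem_union, mem_filter, mem_univ, true_and, not_or, not_exists,
      not_le, not_not] at hf
    obtain ⟨⟨⟨hfdeg, hfcodeg⟩, hinj⟩, hmiss⟩ := hf
    obtain ⟨e, ⟨φ, hφ⟩ | ⟨φ, hφ⟩⟩ :=
      exists_comp_eq_cycleGraph_four hinj (by simpa using hs₅.ne') hfdeg hfcodeg
    exacts [hmiss e (hφ ▸ hQ φ), hmiss e (hφ ▸ hQ' φ)]
  have hsum : Fintype.card V ^ s ≤ #(few G) + #(few Gᶜ) + #collide + #hit := by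
    have hle := card_le_card hcover
    rw [card_univ, Fintype.card_fun, Fintype.card_fin] at hle
    have := card_union_le (few G ∪ few Gᶜ ∪ collide) hit
    have := card_union_le (few G ∪ few Gᶜ) collide
    have := card_union_le (few G) (few Gᶜ)
    omega
  have hfew : (#(few G) : ℝ) ≤ (Fintype.card V : ℝ) ^ s / 8 := by
    simpa only [few, Fintype.card_fin] using
      card_exists_degree_le_quarter_le (ι := Fin s) hε hdeg (by simpa using hs)
  have hfew' : (#(few Gᶜ) : ℝ) ≤ (Fintype.card V : ℝ) ^ s / 8 := by
    simpa only [few, Fintype.card_fin] using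
      card_exists_degree_le_quarter_le (ι := Fin s) hε hcodeg (by simpa using hs)
  have hcollide : 4 * #collide ≤ Fintype.card V ^ s := by
    simpa using four_mul_card_not_injective_le (ι := Fin s) (by simpa using hV)
  have hsum' : (Fintype.card V : ℝ) ^ s ≤ #(few G) + #(few Gᶜ) + #collide + #hit := by
    exact_mod_cast hsum
  have hcollide' : (4 * #collide : ℝ) ≤ (Fintype.card V : ℝ) ^ s := by exact_mod_cast hcollide
  have hhalf : (Fintype.card V : ℝ) ^ s ≤ 2 * #hit := by linarith
  exact_mod_cast hhalf

theorem card_pow_four_le_of_large (hε : 0 < ε)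
    (hdeg : ∀ v, (1 / 4 + ε) * Fintype.card V ≤ G.degree v)
    (hcodeg : ∀ v, (1 / 4 + ε) * Fintype.card V ≤ Gᶜ.degree v) (hs : 2 ^ 14 ≤ ε ^ 4 * s)
    (hV : 4 * s ^ 2 ≤ Fintype.card V) :
    Fintype.card V ^ 4 ≤
      2 * s ^ 4 * (Nat.card (cycleGraph 4 ↪g G) + Nat.card (cycleGraph 4 ↪g Gᶜ)) := by
  classical
  have hs₅ := five_lt_of_le_pow_four_mul hε (lt_one_of_le_degree hdeg) hs
  have := Fintype.ofFinite (cycleGraph 4 ↪g G)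
  have := Fintype.ofFinite (cycleGraph 4 ↪g Gᶜ)
  let Q : Finset (Fin 4 → V) := (univ.image fun φ : cycleGraph 4 ↪g G => ⇑φ) ∪
    univ.image fun φ : cycleGraph 4 ↪g Gᶜ => ⇑φ
  have hQ : #Q ≤ Nat.card (cycleGraph 4 ↪g G) + Nat.card (cycleGraph 4 ↪g Gᶜ) := by
    rw [Nat.card_eq_fintype_card, Nat.card_eq_fintype_card]
    exact (card_union_le ..).trans (add_le_add card_image_le card_image_le)
  have hhalf := card_pow_le_two_mul_card_exists_comp_mem hε hdeg hcodeg hs hV (Q := Q)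
    (fun φ => mem_union_left _ (mem_image_of_mem _ (mem_univ φ)))
    fun φ => mem_union_right _ (mem_image_of_mem _ (mem_univ φ))
  have hle := pow_card_le_of_half_samples (ι := Fin s) (κ := Fin 4) (by simp; omega)
    (by simpa using hhalf)
  simp only [Fintype.card_fin] at hle
  exact hle.trans (Nat.mul_le_mul_left _ hQ)

theorem card_pow_four_le (hcard : Fintype.card V ≠ 5) (hε : 0 < ε)
    (hdeg : ∀ v, (1 / 4 + ε) * Fintype.card V ≤ G.degree v)
    (hcodeg : ∀ v, (1 / 4 + ε) * Fintype.card V ≤ Gᶜ.degree v) (hs : 2 ^ 14 ≤ ε ^ 4 * s) :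
    Fintype.card V ^ 4 ≤
      256 * s ^ 8 * (Nat.card (cycleGraph 4 ↪g G) + Nat.card (cycleGraph 4 ↪g Gᶜ)) := by
  have hs₅ := five_lt_of_le_pow_four_mul hε (lt_one_of_le_degree hdeg) hs
  rcases le_or_gt (4 * s ^ 2) (Fintype.card V) with hlarge | hsmall
  · refine (card_pow_four_le_of_large hε hdeg hcodeg hs hlarge).trans ?_
    gcongr
    · norm_num
    · omega
    · norm_num
  · have hcard₀ : (0 : ℝ) < Fintype.card V := by exact_mod_cast Fintype.card_pos
    have hquarter : ∀ d : ℕ, (1 / 4 + ε) * Fintype.card V ≤ d → Fintype.card V < 4 * d :=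
      fun d hd => by
        have : (Fintype.card V : ℝ) < 4 * d := by nlinarith
        exact_mod_cast this
    have hpos : 1 ≤ Nat.card (cycleGraph 4 ↪g G) + Nat.card (cycleGraph 4 ↪g Gᶜ) := by
      rcases cycleGraph_four_isIndContained_or_compl hcard (fun v => hquarter _ (hdeg v))
        fun v => hquarter _ (hcodeg v) with hφ | hφ <;>
        have := Nat.card_pos_iff.2 ⟨hφ, inferInstance⟩ <;> omega
    calc Fintype.card V ^ 4 ≤ (4 * s ^ 2) ^ 4 := by gcongr
      _ = 256 * s ^ 8 * 1 := by ring
      _ ≤ _ := by gcongr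

end Supersaturation

section Copies

variable {V W : Type*}

theorem labelGraph_zero_eq_compl (c : TopEdgeLabeling V (Fin 2)) :
    c.labelGraph 0 = (c.labelGraph 1)ᶜ := by
  classical
  rw [← c.labelGraph_toTopEdgeLabeling, toTopEdgeLabeling_labelGraph_compl,
    toTopEdgeLabeling_labelGraph]

theorem labelGraph_swapColours (c : TopEdgeLabeling V (Fin 2)) (k : Fin 2) :
    (swapColours c).labelGraph k = c.labelGraph (Equiv.swap 0 1 k) := by
  ext x y
  simp only [TopEdgeLabeling.labelGraph_adj, swapColours, EdgeLabeling.compRight_get,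
    Equiv.swap_apply_eq_iff]

theorem labelGraph_one_C4 : C4.labelGraph 1 = cycleGraph 4 := by
  have hC4 : C4 = (cycleGraph 4).toTopEdgeLabeling := EdgeLabeling.ext_get fun x y _ => by
    simp only [C4, EdgeLabeling.get_mk, toTopEdgeLabeling_get, cycleGraph_adj]
  rw [hC4, toTopEdgeLabeling_labelGraph]

theorem labelGraph_one_swapColours_C4 : (swapColours C4).labelGraph 1 = (cycleGraph 4)ᶜ := by
  rw [labelGraph_swapColours, Equiv.swap_apply_right, labelGraph_zero_eq_compl, labelGraph_one_C4]

theorem labelGraph_one_injective :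
    Function.Injective fun c : TopEdgeLabeling V (Fin 2) => c.labelGraph 1 := by
  classical
  intro c d (h : c.labelGraph 1 = d.labelGraph 1)
  rw [← c.labelGraph_toTopEdgeLabeling, ← d.labelGraph_toTopEdgeLabeling]
  congr!

theorem pullback_toEmbedding_eq {H : TopEdgeLabeling W (Fin 2)} {c : TopEdgeLabeling V (Fin 2)}
    (φ : H.labelGraph 1 ↪g c.labelGraph 1) : c.pullback φ.toEmbedding = H := by
  refine labelGraph_one_injective ?_
  ext x y
  rw [← φ.map_adj_iff]
  simp only [TopEdgeLabeling.labelGraph_adj, φ.injective.ne_iff]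
  rfl

theorem card_embedding_map_eq_le [Fintype W] [Fintype V] [DecidableEq V] (S : Finset V) :
    #{φ : W ↪ V | univ.map φ = S} ≤ (Fintype.card W).factorial := by
  rcases eq_empty_or_nonempty {φ : W ↪ V | univ.map φ = S} with hempty | ⟨φ₀, hφ₀⟩
  · rw [hempty, card_empty]
    exact Nat.zero_le _
  have hS : #S = Fintype.card W := by rw [← (mem_filter.1 hφ₀).2, card_map, card_univ]
  have hmem : ∀ φ : {φ : W ↪ V // univ.map φ = S}, ∀ w, φ.1 w ∈ S := fun φ w => by
    simp [← φ.2]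
  rw [← Fintype.card_subtype]
  calc Fintype.card {φ : W ↪ V // univ.map φ = S} ≤ Fintype.card (W ↪ S) :=
        Fintype.card_le_of_injective (fun φ => φ.1.codRestrict S (hmem φ)) fun φ ψ h =>
          Subtype.ext <| DFunLike.ext _ _ fun w => congrArg Subtype.val (DFunLike.congr_fun h w)
    _ = (Fintype.card W).factorial := by
        rw [Fintype.card_embedding_eq, Fintype.card_coe, hS, Nat.descFactorial_self]

theorem card_labelGraph_embedding_le [Fintype W] [Finite V] (H : TopEdgeLabeling W (Fin 2))
    (c : TopEdgeLabeling V (Fin 2)) :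
    Nat.card (H.labelGraph 1 ↪g c.labelGraph 1) ≤
      (Fintype.card W).factorial * (copies H c).ncard := by
  classical
  have := Fintype.ofFinite V
  have := Fintype.ofFinite (H.labelGraph 1 ↪g c.labelGraph 1)
  rw [Nat.card_eq_fintype_card, ← card_univ, Set.ncard_eq_toFinset_card']
  refine card_le_mul_card_image_of_maps_to (f := fun φ => univ.map φ.toEmbedding)
    (t := (copies H c).toFinset)
    (fun φ _ => Set.mem_toFinset.2 ⟨φ.toEmbedding, rfl, pullback_toEmbedding_eq φ⟩) _ fun S _ => ?_
  refine le_trans ?_ (card_embedding_map_eq_le (W := W) S)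
  exact card_le_card_of_injOn RelEmbedding.toEmbedding (fun φ hφ => by simpa using hφ)
    RelEmbedding.toEmbedding_injective.injOn

theorem card_cycleGraph_four_embedding_le [Finite V] (c : TopEdgeLabeling V (Fin 2)) :
    Nat.card (cycleGraph 4 ↪g c.labelGraph 1) ≤ 24 * (copies C4 c).ncard := by
  have h := card_labelGraph_embedding_le C4 c
  rwa [labelGraph_one_C4] at h

theorem card_cycleGraph_four_embedding_compl_le [Finite V] (c : TopEdgeLabeling V (Fin 2)) :
    Nat.card (cycleGraph 4 ↪g (c.labelGraph 1)ᶜ) ≤ 24 * (copies (swapColours C4) c).ncard := by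
  have h := card_labelGraph_embedding_le (swapColours C4) c
  rw [labelGraph_one_swapColours_C4] at h
  rwa [Nat.card_congr Embedding.complEquiv, compl_compl]

end Copies

section Bounds

variable {V : Type*} [Fintype V] [DecidableEq V] {c : TopEdgeLabeling V (Fin 2)} {ε : ℝ}

theorem IsLocallyBalanced.le_degree_compl {δ : ℝ} (h : IsLocallyBalanced c δ) (v : V) :
    δ * Fintype.card V ≤ (c.labelGraph 1)ᶜ.degree v := by
  refine (h v 0).trans_eq ?_
  congr!
  exact labelGraph_zero_eq_compl c

theorem IsLocallyBalanced.le_one_half [Nonempty V] {δ : ℝ} (h : IsLocallyBalanced c δ) :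
    δ ≤ 1 / 2 := by
  obtain ⟨v⟩ := ‹Nonempty V›
  have hcard : (0 : ℝ) < Fintype.card V := by exact_mod_cast Fintype.card_pos_iff.2 ⟨v⟩
  have hdeg := h v 1
  have hcodeg := h.le_degree_compl v
  have hsum : (c.labelGraph 1).degree v + (c.labelGraph 1)ᶜ.degree v ≤ Fintype.card V := by
    rw [degree_compl]
    have := (c.labelGraph 1).degree_lt_card_verts v
    omega
  have hsum' : ((c.labelGraph 1).degree v + (c.labelGraph 1)ᶜ.degree v : ℝ) ≤ Fintype.card V := by
    exact_mod_cast hsum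
  nlinarith

theorem IsLocallyBalanced.card_pow_four_le [Nonempty V] (h : IsLocallyBalanced c (1 / 4 + ε))
    (hcard : Fintype.card V ≠ 5) (hε : 0 < ε) {s : ℕ} (hs : 2 ^ 14 ≤ ε ^ 4 * s) :
    Fintype.card V ^ 4 ≤
      2 ^ 13 * s ^ 8 * ((copies C4 c).ncard + (copies (swapColours C4) c).ncard) := by
  calc Fintype.card V ^ 4 ≤ 256 * s ^ 8 * (Nat.card (cycleGraph 4 ↪g c.labelGraph 1) +
        Nat.card (cycleGraph 4 ↪g (c.labelGraph 1)ᶜ)) :=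
        LocallyBalanced.card_pow_four_le hcard hε (fun v => h v 1) h.le_degree_compl hs
    _ ≤ 256 * s ^ 8 * (24 * (copies C4 c).ncard + 24 * (copies (swapColours C4) c).ncard) := by
        gcongr
        · exact card_cycleGraph_four_embedding_le c
        · exact card_cycleGraph_four_embedding_compl_le c
    _ = 6144 * s ^ 8 * ((copies C4 c).ncard + (copies (swapColours C4) c).ncard) := by ring
    _ ≤ _ := by
        gcongr
        norm_num

theorem exists_nat_between_sample_bounds (hε : 0 < ε) (hε₁ : ε ≤ 1) :
    ∃ s : ℕ, 2 ^ 14 ≤ ε ^ 4 * s ∧ ε ^ 4 * s ≤ 2 ^ 15 := by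
  have hε₄ : 0 < ε ^ 4 := by positivity
  refine ⟨⌈2 ^ 14 / ε ^ 4⌉₊, ?_, ?_⟩
  · rw [mul_comm, ← div_le_iff₀ hε₄]
    exact Nat.le_ceil _
  · have hceil := Nat.ceil_lt_add_one (a := 2 ^ 14 / ε ^ 4) (by positivity)
    have hone : ε ^ 4 ≤ 1 := pow_le_one₀ hε.le hε₁
    calc ε ^ 4 * ⌈2 ^ 14 / ε ^ 4⌉₊ ≤ ε ^ 4 * (2 ^ 14 / ε ^ 4 + 1) := by gcongr
      _ = 2 ^ 14 + ε ^ 4 := by field_simp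
      _ ≤ 2 ^ 15 := by linarith

theorem IsLocallyBalanced.mul_card_pow_four_le_add [Nonempty V]
    (h : IsLocallyBalanced c (1 / 4 + ε)) (hcard : Fintype.card V ≠ 5) (hε : 0 < ε) :
    ε ^ 32 * (Fintype.card V : ℝ) ^ 4 ≤
      2 ^ 133 * ((copies C4 c).ncard + (copies (swapColours C4) c).ncard) := by
  obtain ⟨s, hs, hs'⟩ := exists_nat_between_sample_bounds hε (by linarith [h.le_one_half])
  have hcount : (Fintype.card V : ℝ) ^ 4 ≤
      2 ^ 13 * s ^ 8 * ((copies C4 c).ncard + (copies (swapColours C4) c).ncard) := by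
    exact_mod_cast h.card_pow_four_le hcard hε hs
  calc ε ^ 32 * (Fintype.card V : ℝ) ^ 4
      ≤ ε ^ 32 *
          (2 ^ 13 * s ^ 8 * ((copies C4 c).ncard + (copies (swapColours C4) c).ncard)) := by gcongr
    _ = 2 ^ 13 * (ε ^ 4 * s) ^ 8 *
          ((copies C4 c).ncard + (copies (swapColours C4) c).ncard) := by ring
    _ ≤ 2 ^ 13 * (2 ^ 15) ^ 8 *
          ((copies C4 c).ncard + (copies (swapColours C4) c).ncard) := by gcongr
    _ = _ := by ring

theorem two_rpow_neg_log_pow_le (hε : 0 < ε) (hε₄ : ε ≤ 1 / 4) :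
    (2 : ℝ) ^ (-198 * Real.log (1 / ε) ^ 8) ≤ ε ^ 32 / 2 ^ 134 := by
  set L := Real.log (1 / ε) with hL
  have hlog₂ := Real.log_two_gt_d9
  have hL₁ : 1 ≤ L := by
    have hmono : Real.log 4 ≤ L :=
      Real.log_le_log (by norm_num) (by rw [le_div_iff₀ hε]; linarith)
    have hlog₄ : Real.log 4 = 2 * Real.log 2 := by
      rw [← Real.log_rpow two_pos]
      norm_num
    linarith
  have hL₈ : L ≤ L ^ 8 := le_self_pow₀ hL₁ (by norm_num)
  have hεL : ε ^ 32 = Real.exp (-(32 * L)) := by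
    rw [hL, one_div, Real.log_inv, mul_neg, neg_neg, ← Real.exp_log (pow_pos hε 32),
      Real.log_pow]
    norm_num
  have hε₃₂ : (2 : ℝ) ^ (-64 * L ^ 8) ≤ ε ^ 32 := by
    rw [hεL, Real.rpow_def_of_pos two_pos]
    exact Real.exp_le_exp.2 (by nlinarith)
  have hconst : (2 : ℝ) ^ (-134 * L ^ 8) ≤ (2 ^ 134)⁻¹ := by
    rw [← Real.rpow_natCast 2 134, ← Real.rpow_neg zero_le_two]
    refine Real.rpow_le_rpow_of_exponent_le one_le_two ?_
    push_cast
    linarith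
  calc (2 : ℝ) ^ (-198 * L ^ 8) = 2 ^ (-64 * L ^ 8) * 2 ^ (-134 * L ^ 8) := by
        rw [← Real.rpow_add two_pos]
        ring_nf
    _ ≤ ε ^ 32 * (2 ^ 134)⁻¹ := by gcongr
    _ = _ := (div_eq_mul_inv ..).symm

theorem IsLocallyBalanced.two_rpow_mul_card_pow_four_le (h : IsLocallyBalanced c (1 / 4 + ε))
    (hε : 0 < ε) : (2 : ℝ) ^ (-198 * Real.log (1 / ε) ^ 8) * (Fintype.card V : ℝ) ^ 4 ≤
      ε ^ 32 / 2 ^ 134 * (Fintype.card V : ℝ) ^ 4 := by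
  cases isEmpty_or_nonempty V
  · simp
  · gcongr
    exact two_rpow_neg_log_pow_le hε (by linarith [h.le_one_half])

end Bounds

end LocallyBalanced

theorem mainTheorem6_general {V : Type*} [Fintype V] [DecidableEq V]
    {c : SimpleGraph.TopEdgeLabeling V (Fin 2)} {ε : ℝ} (hcard : Fintype.card V ≠ 5) (hε : 0 < ε)
    (h : LocallyBalanced.IsLocallyBalanced c (1 / 4 + ε)) :
    ε ^ 32 / 2 ^ 134 * (Fintype.card V : ℝ) ^ 4
        ≤ ((LocallyBalanced.copies LocallyBalanced.C4 c).ncard : ℝ) ∨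
      ε ^ 32 / 2 ^ 134 * (Fintype.card V : ℝ) ^ 4
        ≤ ((LocallyBalanced.copies
            (LocallyBalanced.swapColours LocallyBalanced.C4) c).ncard : ℝ) := by
  cases isEmpty_or_nonempty V
  · exact Or.inl (by simp)
  have hsum := h.mul_card_pow_four_le_add hcard hε
  by_contra! hfew
  rw [div_mul_eq_mul_div, lt_div_iff₀ (by norm_num), lt_div_iff₀ (by norm_num)] at hfew
  linarith

theorem mainTheorem6 :
    ∃ C₁ : ℝ, 0 < C₁ ∧
      ∀ (n : ℕ) (ε : ℝ) (c : SimpleGraph.TopEdgeLabeling (Fin n) (Fin 2)),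
        n ≠ 5 → 0 < ε → LocallyBalanced.IsLocallyBalanced c (1 / 4 + ε) →
          (2 : ℝ) ^ (-C₁ * Real.log (1 / ε) ^ 8) * (n : ℝ) ^ 4
              ≤ ((LocallyBalanced.copies LocallyBalanced.C4 c).ncard : ℝ) ∨
          (2 : ℝ) ^ (-C₁ * Real.log (1 / ε) ^ 8) * (n : ℝ) ^ 4
              ≤ ((LocallyBalanced.copies
                  (LocallyBalanced.swapColours LocallyBalanced.C4) c).ncard : ℝ) := by
  refine ⟨198, by norm_num, fun n ε c hn hε h => ?_⟩
  have hle := h.two_rpow_mul_card_pow_four_le hε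
  rw [Fintype.card_fin] at hle
  have hcopies := mainTheorem6_general (by simpa using hn) hε h
  rw [Fintype.card_fin] at hcopies
  exact hcopies.imp hle.trans hle.trans
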